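/- A complex manifold $S$ is called elliptic if there exist a holomorphic vector bundle $E\to S$ and a holomorphic map $s:E\to S$ such that, for every $x\in S$, $s(0_x)=x$ and the restriction $s|_{E_x}:E_x\to S$ is a submersion at $0_x$. Let $\mathrm{SO}^0(2,1)$ be the identity component of the special orthogonal group of the form $x_1^2+x_2^2-x_3^2$ on $\mathbb R^3$; call an element of it hyperbolic if it has three distinct real eigenvalues. An affine automorphism $\gamma(x)=Ax+b$ of $\mathbb R^3$ acts on $\mathbb C^3$ by the same formula, $\gamma(z)=Az+b$. Write $F_k$ for the free group of rank $k$, and let $\mathbb N$ include $0$. Theorem. There is a group $\Gamma\cong F_2$ of affine automorphisms of $\mathbb R^3$, acting freely and properly discontinuously on $\mathbb R^3$, in which every element other than the identity has as linear part a hyperbolic element of $\mathrm{SO}^0(2,1)$ (as in Margulis's example), such that $\Gamma$ also acts freely and properly discontinuously on $\mathbb C^3$, and such that the following holds. For every $k\in\mathbb N\cup\{\aleph_0\}$ there is a subgroup $\Gamma'\subset\Gamma$ with $\Gamma'\cong F_k$ such that the quotient $S=\mathbb C^3/\Gamma'$, with the complex structure for which the projection $\mathbb C^3\to S$ is locally biholomorphic,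 is a 3-dimensional (Hausdorff, second countable) elliptic complex manifold with $\pi_1(S)\cong F_k$ and $\pi_n(S)=0$ for all $n>1$. In particular, for every $k\in\mathbb N\cup\{\aleph_0\}$ there is a 3-dimensional elliptic manifold $S$ with $\pi_1(S)\cong F_k$ and $\pi_n(S)=0$ for all $n>1$. -/

import Mathlib

open scoped Manifold ContDiff

/-- The free group `F_k` of rank `k ∈ {0, 1, 2, …} ∪ {ℵ₀}`; here `⊤ : ℕ∞` stands for `ℵ₀`. -/
abbrev FreeGroupOfRank (k : ℕ∞) : Type := FreeGroup {i : ℕ // (i : ℕ∞) < k}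

/-! ### Elliptic complex manifolds -/

section Elliptic

variable (n : ℕ) (M : Type*) [TopologicalSpace M] [ChartedSpace (Fin n → ℂ) M]

/-- `M` has a dominating spray: a holomorphic vector bundle `V → M` (with model fibre `ℂ^r`) and a
holomorphic map `s` from its total space to `M` such that `s(0_x) = x` and the restriction of `s`
to the fibre over `x` is a submersion at `0_x`, for every `x`. The fibre `V x` is identified with
`ℂ^r` by the fibrewise linear isomorphism that the trivialization around `x` provides.
Over `ℂ`, the smoothness exponent `ω` means holomorphic. -/
def HasDominatingSpray : Prop :=
  ∃ (r : ℕ) (V : M → Type) (_ : ∀ x, AddCommGroup (V x)) (_ : ∀ x, Module ℂ (V x))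
    (_ : ∀ x, TopologicalSpace (V x))
    (_ : TopologicalSpace (Bundle.TotalSpace (Fin r → ℂ) V))
    (_ : FiberBundle (Fin r → ℂ) V) (_ : VectorBundle ℂ (Fin r → ℂ) V)
    (_ : ContMDiffVectorBundle ω (Fin r → ℂ) V 𝓘(ℂ, Fin n → ℂ))
    (s : Bundle.TotalSpace (Fin r → ℂ) V → M),
    ContMDiff (𝓘(ℂ, Fin n → ℂ).prod 𝓘(ℂ, Fin r → ℂ)) 𝓘(ℂ, Fin n → ℂ) ω s ∧
    (∀ x : M, s ⟨x, 0⟩ = x) ∧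
    ∀ x : M, Function.Surjective
      (mfderiv 𝓘(ℂ, Fin r → ℂ) 𝓘(ℂ, Fin n → ℂ)
        (fun v : Fin r → ℂ => s ⟨x, (trivializationAt (Fin r → ℂ) V x).symm x v⟩) 0)

/-- `M`, with its given atlas of charts into `ℂ^n`, is an elliptic complex manifold of complex
dimension `n`: it is Hausdorff and second countable, the chart changes are holomorphic, and there
is a dominating spray. -/
structure IsEllipticManifold : Prop where
  t2 : T2Space M
  secondCountable : SecondCountableTopology M
  isManifold : IsManifold 𝓘(ℂ, Fin n → ℂ) ω M
  spray : HasDominatingSpray n M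

end Elliptic

/-! ### Affine groups of Margulis type on `ℝ³`, and their action on `ℂ³` -/

/-- The group of affine automorphisms of `ℝ³`. -/
abbrev AffR3 : Type := (Fin 3 → ℝ) ≃ᵃ[ℝ] (Fin 3 → ℝ)

namespace AffR3

/-- The matrix `A` of the linear part of `γ(x) = A x + b`. -/
def linMatrix (γ : AffR3) : Matrix (Fin 3) (Fin 3) ℝ :=
  LinearMap.toMatrix' (γ.linear : (Fin 3 → ℝ) →ₗ[ℝ] (Fin 3 → ℝ))

/-- The translation part `b` of `γ(x) = A x + b`. -/
def translation (γ : AffR3) : Fin 3 → ℝ := γ 0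

theorem apply_eq (γ : AffR3) (x : Fin 3 → ℝ) :
    γ x = (γ.linMatrix).mulVec x + γ.translation := by
  have h := γ.map_vadd 0 x
  simp only [vadd_eq_add, add_zero] at h
  rw [h, linMatrix, translation, ← Matrix.toLin'_apply, Matrix.toLin'_toMatrix']
  rfl

theorem linMatrix_one : linMatrix 1 = 1 := by
  change LinearMap.toMatrix' (LinearMap.id : (Fin 3 → ℝ) →ₗ[ℝ] (Fin 3 → ℝ)) = 1
  exact LinearMap.toMatrix'_id

theorem linMatrix_mul (γ δ : AffR3) : linMatrix (γ * δ) = linMatrix γ * linMatrix δ := by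
  change LinearMap.toMatrix' ((γ.linear : (Fin 3 → ℝ) →ₗ[ℝ] (Fin 3 → ℝ)).comp
    (δ.linear : (Fin 3 → ℝ) →ₗ[ℝ] (Fin 3 → ℝ))) = _
  exact LinearMap.toMatrix'_comp _ _

theorem translation_mul (γ δ : AffR3) :
    translation (γ * δ) = (linMatrix γ).mulVec (translation δ) + translation γ :=
  apply_eq γ (δ 0)

/-- Affine automorphisms act on `ℝ³` by evaluation. -/
instance : MulAction AffR3 (Fin 3 → ℝ) where
  smul γ x := γ x
  one_smul _ := rfl
  mul_smul _ _ _ := rfl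

theorem smul_real_def (γ : AffR3) (x : Fin 3 → ℝ) : γ • x = γ x := rfl

/-- A real affine automorphism `γ(x) = A x + b` acts on `ℂ³` by the same formula,
`γ(z) = A z + b`. -/
noncomputable instance : MulAction AffR3 (Fin 3 → ℂ) where
  smul γ z := (γ.linMatrix.map Complex.ofReal).mulVec z + fun i => (γ.translation i : ℂ)
  one_smul z := by
    change ((linMatrix 1).map Complex.ofReal).mulVec z + (fun i => (translation 1 i : ℂ)) = z
    have h : translation 1 = 0 := rfl
    rw [linMatrix_one, h, Matrix.map_one _ Complex.ofReal_zero Complex.ofReal_one,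
      Matrix.one_mulVec]
    ext i
    simp
  mul_smul γ δ z := by
    change ((linMatrix (γ * δ)).map Complex.ofReal).mulVec z + (fun i => (translation (γ * δ) i : ℂ)) =
      (γ.linMatrix.map Complex.ofReal).mulVec
        ((δ.linMatrix.map Complex.ofReal).mulVec z + fun i => (δ.translation i : ℂ)) +
        fun i => (γ.translation i : ℂ)
    have h1 : (linMatrix (γ * δ)).map Complex.ofReal =
        (linMatrix γ).map Complex.ofReal * (linMatrix δ).map Complex.ofReal := by
      rw [linMatrix_mul]
      exact Matrix.map_mul (f := Complex.ofRealHom)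
    have h2 : (fun i => (translation (γ * δ) i : ℂ)) =
        ((linMatrix γ).map Complex.ofReal).mulVec (fun i => (δ.translation i : ℂ)) +
          fun i => (γ.translation i : ℂ) := by
      rw [translation_mul]
      ext i
      simp [Matrix.mulVec, dotProduct]
    rw [h1, h2, Matrix.mulVec_add, Matrix.mulVec_mulVec, add_assoc]

theorem smul_complex_def (γ : AffR3) (z : Fin 3 → ℂ) :
    γ • z = (γ.linMatrix.map Complex.ofReal).mulVec z + fun i => (γ.translation i : ℂ) := rfl

end AffR3

/-- The group `SO(2,1)`: the real matrices of determinant one that preserve the quadratic form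
`x₀² + x₁² - x₂²`. -/
def SO21 : Set (Matrix (Fin 3) (Fin 3) ℝ) :=
  {A | A.transpose * Matrix.diagonal ![1, 1, -1] * A = Matrix.diagonal ![1, 1, -1] ∧ A.det = 1}

/-- The group `SO⁰(2,1)`: the connected component of the identity in `SO(2,1)`. -/
def SO21Identity : Set (Matrix (Fin 3) (Fin 3) ℝ) := connectedComponentIn SO21 1

/-- An element of `SO⁰(2,1)` is hyperbolic if it has three distinct real eigenvalues. -/
def IsHyperbolicSO21 (A : Matrix (Fin 3) (Fin 3) ℝ) : Prop :=
  A ∈ SO21Identity ∧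
    ∃ l : Fin 3 → ℝ, Function.Injective l ∧
      ∀ i, Module.End.HasEigenvalue (Matrix.toLin' A) (l i)

/-- `Γ` is a group of affine automorphisms of `ℝ³` as in Margulis's example: it is free of rank
two, it acts freely and properly discontinuously on `ℝ³`, and the linear part of each element other
than the identity is a hyperbolic element of `SO⁰(2,1)`. -/
structure IsMargulisGroup (Γ : Subgroup AffR3) : Prop where
  free_rank_two : Nonempty (Γ ≃* FreeGroupOfRank 2)
  acts_freely : ∀ γ : Γ, γ ≠ 1 → ∀ x : Fin 3 → ℝ, γ • x ≠ x
  properlyDiscontinuous : ProperlyDiscontinuousSMul Γ (Fin 3 → ℝ)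
  hyperbolic : ∀ γ ∈ Γ, γ ≠ 1 → IsHyperbolicSO21 γ.linMatrix

/-- The quotient `ℂ³/Γ`, with the quotient topology. -/
abbrev ComplexQuotient (Γ : Subgroup AffR3) : Type :=
  Quotient (MulAction.orbitRel Γ (Fin 3 → ℂ))

/-- The projection `ℂ³ → ℂ³/Γ`. -/
noncomputable def ComplexQuotient.proj (Γ : Subgroup AffR3) : (Fin 3 → ℂ) → ComplexQuotient Γ :=
  Quotient.mk (MulAction.orbitRel Γ (Fin 3 → ℂ))

/-!
The linear parts of the group `Γ` are generated by two Lorentz boosts `a` and `b` in orthogonal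
directions, so strong that they play ping-pong on the null cone: there are four disjoint sectors of
null vectors, one for each of `a, b, a⁻¹, b⁻¹`, and a letter `s` maps every sector other than that
of `s⁻¹` into its own sector, stretching the vectors (`letterMatrix_mem_region`). A cyclically
reduced word therefore has an eigenvector in the sector of its first letter, with eigenvalue
`l > 1`; in `SO(2,1)` the other eigenvalues are then `1` and `l⁻¹` (`isHyperbolicSO21_rep`). In
particular the group is free.

The translation part of each generator is a fixed vector of its boost. For null vectors `p, q` let
`margulis u p q` be the Lorentz product of `u` with the unit vector orthogonal to both. With
these translation parts, `margulis` of a letter is at least `1/10` if `p` is in the sector of the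
letter and `q` is in another one (`margulis_letterTranslation_ge`). By invariance, `margulis` of the
translation part of a reduced word is a sum of such terms over its letters, so it grows linearly
with the length (`margulis_translation_wordAff_ge`). On the other hand it is bounded if the word
moves a point of a compact set to another point of this set. Hence only finitely many words do so
(`length_toWord_le`), and the action on `ℝ³` is properly discontinuous. It is free since `Γ` is
torsion-free. Taking real parts is an equivariant map `ℂ³ → ℝ³`, so both properties pass to `ℂ³`.

The quotient `S` of `ℂ³` by a subgroup is a manifold whose chart changes are locally elements of the
group. The map `(z, v) ↦ z + v` is compatible with affine transformations, hence it descends to a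
dominating spray on the tangent bundle of `S`
(`IsQuotientCoveringMap.hasDominatingSpray_of_affine`). As `ℂ³` is contractible, `π₁(S)` is the
group and the higher homotopy groups vanish. Finally, the elements `aⁿ b a⁻ⁿ` of a free group on
`a, b` are free generators (`FreeGroup.conjPowHom_injective`), which yields subgroups of all
countable ranks.
-/

/-! ### Free subgroups of a free group of rank two -/

namespace FreeGroup

variable {ι : Type*}

/-- The homomorphism from the free group on `x₀, x₁, …` that sends `xₙ` to `aⁿ b a⁻ⁿ`. -/
def conjPowHom (a b : ι) : FreeGroup ℕ →* FreeGroup ι :=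
  lift fun n => of a ^ n * of b * (of a ^ n)⁻¹

/-- The free group on `a, b` acts on the set `F(ℤ)` with `a` shifting the generators and `b`
multiplying by the generator `x₀` from the left. Then `aⁿ b a⁻ⁿ` multiplies by `xₙ`, so the image
of `w` under `conjPowHom` can be read off from where it moves `1`. -/
theorem conjPowHom_injective {a b : ι} (hab : a ≠ b) : Function.Injective (conjPowHom a b) := by
  classical
  let sh : Equiv.Perm (FreeGroup ℤ) := (freeGroupCongr (Equiv.addRight (1 : ℤ))).toEquiv
  let ψ : FreeGroup ι →* Equiv.Perm (FreeGroup ℤ) :=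
    lift fun i => if i = a then sh else Equiv.mulLeft (of 0)
  have hsh : ∀ n : ℕ, ∀ w : FreeGroup ℤ, (sh ^ n) w = map (fun m : ℤ => m + n) w := by
    intro n
    induction n with
    | zero => intro w; simp
    | succ n ih =>
      intro w
      rw [pow_succ', Equiv.Perm.mul_apply, ih]
      change map _ (map _ w) = _
      rw [map.comp]
      congr 2
      ext m
      simp [add_assoc]
  have key : ∀ w : FreeGroup ℕ,
      ψ (conjPowHom a b w) =
        MulAction.toPermHom _ (FreeGroup ℤ) (map (fun n : ℕ => (n : ℤ)) w) := by
    intro w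
    have : ψ.comp (conjPowHom a b) =
        (MulAction.toPermHom (FreeGroup ℤ) (FreeGroup ℤ)).comp (map (fun n : ℕ => (n : ℤ))) := by
      ext n x
      have h1 : ∀ y, (sh ^ n) (of 0 * ((sh ^ n)⁻¹ y)) = of (n : ℤ) * y := by
        intro y
        rw [hsh, _root_.map_mul, ← hsh n ((sh ^ n)⁻¹ y), ← Equiv.Perm.mul_apply, mul_inv_cancel]
        simp
      simpa [ψ, conjPowHom, hab.symm] using h1 x
    exact DFunLike.congr_fun this w
  intro w w' h
  have h' := key w
  rw [h, key w'] at h'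
  have h2 := congrArg (fun σ : Equiv.Perm (FreeGroup ℤ) => σ 1) h'
  have h3 : map (fun n : ℕ => (n : ℤ)) w' = map (fun n : ℕ => (n : ℤ)) w := by
    simpa using h2
  exact (map_injective Nat.cast_injective h3).symm

end FreeGroup

/-- A group that is free of rank two contains free subgroups of all countable ranks. -/
theorem exists_subgroup_mulEquiv_freeGroupOfRank {G : Type*} [Group G]
    (e : G ≃* FreeGroupOfRank 2) (k : ℕ∞) :
    ∃ H : Subgroup G, Nonempty (H ≃* FreeGroupOfRank k) := by
  let a : {i : ℕ // (i : ℕ∞) < 2} := ⟨0, by norm_num⟩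
  let b : {i : ℕ // (i : ℕ∞) < 2} := ⟨1, by norm_num⟩
  have hab : a ≠ b := by simp [a, b]
  let f : FreeGroupOfRank k →* G :=
    (e.symm : FreeGroupOfRank 2 →* G).comp
      ((FreeGroup.conjPowHom a b).comp (FreeGroup.map Subtype.val))
  have hf : Function.Injective f :=
    e.symm.injective.comp ((FreeGroup.conjPowHom_injective hab).comp
      (FreeGroup.map_injective Subtype.val_injective))
  exact ⟨f.range, ⟨(MonoidHom.ofInjective hf).symm⟩⟩

/-! ### Higher homotopy groups of a space covered by a vector space -/

section HigherHomotopy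

open scoped unitInterval Topology

variable {E X : Type*} [AddCommGroup E] [Module ℝ E] [TopologicalSpace E] [IsTopologicalAddGroup E]
  [ContinuousSMul ℝ E] [TopologicalSpace X] {p : E → X}

/-- Maps from a cube lift through a covering map; the lift is obtained from the lift of the
composition with the retraction of `ℝⁿ` onto the cube. -/
theorem IsCoveringMap.exists_lift_cube {E X : Type*} [TopologicalSpace E] [TopologicalSpace X]
    {p : E → X} (hp : IsCoveringMap p) {n : ℕ} (f : C(I^ Fin n, X)) (e₀ : E)
    (he : p e₀ = f 0) : ∃ F : C(I^ Fin n, E), F 0 = e₀ ∧ ∀ y, p (F y) = f y := by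
  let ret : C(Fin n → ℝ, I^ Fin n) :=
    ⟨fun y i => Set.projIcc (0 : ℝ) 1 zero_le_one (y i),
      continuous_pi fun i => continuous_projIcc.comp (continuous_apply i)⟩
  let inc : C(I^ Fin n, Fin n → ℝ) := ⟨fun y i => (y i : ℝ), by fun_prop⟩
  have hri : ∀ y, ret (inc y) = y := fun y => by
    funext i
    exact Set.projIcc_val zero_le_one (y i)
  have h0 : inc 0 = 0 := rfl
  obtain ⟨F, ⟨hF0, hF⟩, -⟩ := hp.existsUnique_continuousMap_lifts (f.comp ret) 0 e₀
    (by rw [he, ContinuousMap.comp_apply, ← h0, hri])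
  refine ⟨F.comp inc, by rw [ContinuousMap.comp_apply, h0, hF0], fun y => ?_⟩
  have := congrFun hF (inc y)
  simpa [hri] using this

/-- A lift of a generalized loop is constant on each face of the cube, since the faces are
connected, and for `n > 1` any face can be joined to the origin through another one. -/
theorem IsCoveringMap.lift_eq_of_mem_boundary {E X : Type*} [TopologicalSpace E]
    [TopologicalSpace X] {p : E → X} (hp : IsCoveringMap p) {n : ℕ} (hn : 1 < n) {x : X}
    (f : GenLoop (Fin n) X x) (F : C(I^ Fin n, E)) (hF : ∀ y, p (F y) = f y)
    {y : I^ Fin n} (hy : y ∈ Cube.boundary (Fin n)) : F y = F 0 := by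
  have : PathConnectedSpace I := isPathConnected_iff_pathConnectedSpace.mp
    ((convex_Icc (0 : ℝ) 1).isPathConnected ⟨0, by simp⟩)
  have face : ∀ (i : Fin n) (y y' : I^ Fin n), (y i = 0 ∨ y i = 1) → y' i = y i → F y = F y' := by
    intro i y y' hi hii
    let γ : I → I^ Fin n := fun t k =>
      if k = i then y i else PathConnectedSpace.somePath (y k) (y' k) t
    have hγ : Continuous γ := by
      refine continuous_pi fun k => ?_
      by_cases hk : k = i
      · simp only [γ, hk, if_true]
        exact continuous_const
      · simp only [γ, hk, if_false]
        exact (PathConnectedSpace.somePath (y k) (y' k)).continuous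
    have hb : ∀ t, p (F (γ t)) = x := fun t => by
      rw [hF]
      exact f.2 _ ⟨i, by simpa [γ] using hi⟩
    have h := hp.const_of_comp (F.continuous.comp hγ) (fun t t' => (hb t).trans (hb t').symm) 0 1
    have h0 : γ 0 = y := by
      funext k
      by_cases hk : k = i
      · simp [γ, hk]
      · simp [γ, hk]
    have h1 : γ 1 = y' := by
      funext k
      by_cases hk : k = i
      · simp [γ, hk, hii]
      · simp [γ, hk]
    simpa [h0, h1] using h
  obtain ⟨i, hi⟩ := hy
  have : Nontrivial (Fin n) := Fin.nontrivial_iff_two_le.mpr hn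
  obtain ⟨j, hj⟩ := exists_ne i
  rw [face i y (Function.update y j 0) hi (by simp [hj.symm]),
    face j (Function.update y j 0) 0 (by simp) (by simp)]

/-- If `X` is covered by a real topological vector space, then `πₙ(X) = 0` for `n > 1`. -/
theorem IsCoveringMap.subsingleton_homotopyGroup (hp : IsCoveringMap p)
    (hs : Function.Surjective p) {n : ℕ} (hn : 1 < n) (x : X) :
    Subsingleton (HomotopyGroup.Pi n X x) := by
  obtain ⟨e₀, he₀⟩ := hs x
  have h0 : (0 : I^ Fin n) ∈ Cube.boundary (Fin n) := ⟨⟨0, by omega⟩, Or.inl rfl⟩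
  refine ⟨fun a b => Quotient.inductionOn₂ a b fun f g => Quotient.sound ?_⟩
  obtain ⟨F, hF0, hF⟩ := hp.exists_lift_cube f.1 e₀ (he₀.trans (f.2 _ h0).symm)
  obtain ⟨G, hG0, hG⟩ := hp.exists_lift_cube g.1 e₀ (he₀.trans (g.2 _ h0).symm)
  have hFb : ∀ y ∈ Cube.boundary (Fin n), F y = e₀ := fun y hy =>
    (hp.lift_eq_of_mem_boundary hn f F hF hy).trans hF0
  have hGb : ∀ y ∈ Cube.boundary (Fin n), G y = e₀ := fun y hy =>
    (hp.lift_eq_of_mem_boundary hn g G hG hy).trans hG0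
  refine ⟨{ toFun := fun ty => p ((1 - (ty.1 : ℝ)) • F ty.2 + (ty.1 : ℝ) • G ty.2)
            continuous_toFun := hp.continuous.comp (by fun_prop)
            map_zero_left := fun y => by simpa using hF y
            map_one_left := fun y => by simpa using hG y
            prop' := fun t y hy => ?_ }⟩
  change p ((1 - (t : ℝ)) • F y + (t : ℝ) • G y) = f.1 y
  rw [hFb y hy, hGb y hy, ← add_smul, sub_add_cancel, one_smul, he₀]
  exact (f.2 y hy).symm

end HigherHomotopy

/-! ### Quotients of `ℂⁿ` by affine group actions -/

section AffineQuotient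

open scoped Topology
open Filter Bundle

variable {n : ℕ} {X : Type*} [TopologicalSpace X] {p : (Fin n → ℂ) → X}
  {G : Type*} [Group G] [MulAction G (Fin n → ℂ)]

/-- The complex structure on the base of a surjective local homeomorphism from `ℂⁿ`; its charts
are all the local inverses. -/
@[reducible]
noncomputable def IsLocalHomeomorph.localInverseChartedSpace (hp : IsLocalHomeomorph p)
    (hs : Function.Surjective p) : ChartedSpace (Fin n → ℂ) X where
  atlas := {e | ⇑e.symm = p}
  chartAt x := hp.localInverseAt (Function.surjInv hs x)
  mem_chart_source x := by
    have h := hp.apply_self_mem_localInverseAt_source (x := Function.surjInv hs x)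
    rwa [Function.surjInv_eq hs] at h
  chart_mem_atlas x := hp.localInverseAt_symm _

/-- Two local inverses of the quotient map differ near a common point by an element of the
group. -/
theorem IsQuotientCoveringMap.exists_eventually_eq_smul (hp : IsQuotientCoveringMap p G)
    {e e' : OpenPartialHomeomorph X (Fin n → ℂ)} (he : ⇑e.symm = p) (he' : ⇑e'.symm = p) {x : X}
    (hx : x ∈ e.source) (hx' : x ∈ e'.source) :
    ∃ g : G, ∀ᶠ y in 𝓝 x, e' y = g • e y := by
  have := hp.toContinuousConstSMul
  have h1 : p (e' x) = p (e x) := by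
    nth_rewrite 1 [← he']
    rw [← he, e.left_inv hx, e'.left_inv hx']
  obtain ⟨g, hg⟩ := hp.apply_eq_iff_mem_orbit.mp h1
  refine ⟨g, ?_⟩
  have hc : ContinuousAt (fun y => g • e y) x :=
    (continuous_const_smul g).continuousAt.comp (e.continuousAt hx)
  have hmem : g • e x ∈ e'.target := by
    change g • e x = e' x at hg
    rw [hg]
    exact e'.map_source hx'
  filter_upwards [hc.preimage_mem_nhds (e'.open_target.mem_nhds hmem),
    e.open_source.mem_nhds hx] with y hy hye
  have h2 : e'.symm (g • e y) = y := by
    rw [he', hp.map_smul, ← he, e.left_inv hye]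
  have h3 := e'.right_inv hy
  rwa [h2] at h3

variable (hp : IsQuotientCoveringMap p G) (lin : G → (Fin n → ℂ) →L[ℂ] (Fin n → ℂ))
  (hlin : ∀ g z v, g • (z + v) = g • z + lin g v)

include hlin in
theorem contDiff_smul_of_affine (g : G) : ContDiff ℂ ω fun z : Fin n → ℂ => g • z := by
  have : (fun z : Fin n → ℂ => g • z) = fun z => g • (0 : Fin n → ℂ) + lin g z := by
    funext z
    rw [← hlin, zero_add]
  rw [this]
  exact contDiff_const.add (lin g).contDiff

include hlin in
theorem hasFDerivAt_smul_of_affine (g : G) (z : Fin n → ℂ) :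
    HasFDerivAt (fun z : Fin n → ℂ => g • z) (lin g) z := by
  have : (fun z : Fin n → ℂ => g • z) = fun z => g • (0 : Fin n → ℂ) + lin g z := by
    funext z
    rw [← hlin, zero_add]
  rw [this]
  exact (lin g).hasFDerivAt.const_add _

include hlin in
/-- The quotient of `ℂⁿ` by a group of affine transformations is a complex manifold: the chart changes are
locally given by the group elements. -/
theorem IsQuotientCoveringMap.isManifold_of_affine :
    letI := hp.isCoveringMap.isLocalHomeomorph.localInverseChartedSpace hp.surjective
    IsManifold 𝓘(ℂ, Fin n → ℂ) ω X := by
  let _ := hp.isCoveringMap.isLocalHomeomorph.localInverseChartedSpace hp.surjective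
  refine isManifold_of_contDiffOn _ _ _ fun e e' he he' => ?_
  intro z hz
  have hz' : z ∈ (e.symm ≫ₕ e').source := by simpa using hz
  have hz1 : z ∈ e.target := by simpa using (show z ∈ e.symm.source from hz'.1)
  have hz2 : e.symm z ∈ e'.source := hz'.2
  obtain ⟨g, hg⟩ := hp.exists_eventually_eq_smul he he' (e.map_target hz1) hz2
  refine ContDiffAt.contDiffWithinAt ?_
  refine (contDiff_smul_of_affine lin hlin g).contDiffAt.congr_of_eventuallyEq ?_
  filter_upwards [(e.symm.continuousAt (x := z) hz1).eventually hg,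
    e.open_target.mem_nhds hz1] with y hy hyt
  simp only [mfld_simps]
  rw [hy, e.right_inv hyt]

include hlin in
theorem IsQuotientCoveringMap.isLocalDiffeomorph_of_affine :
    letI := hp.isCoveringMap.isLocalHomeomorph.localInverseChartedSpace hp.surjective
    IsLocalDiffeomorph 𝓘(ℂ, Fin n → ℂ) 𝓘(ℂ, Fin n → ℂ) ω p := by
  let _ := hp.isCoveringMap.isLocalHomeomorph.localInverseChartedSpace hp.surjective
  have := hp.isManifold_of_affine lin hlin
  intro z
  let e := hp.isCoveringMap.isLocalHomeomorph.localInverseAt z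
  have hes : ⇑e.symm = p := hp.isCoveringMap.isLocalHomeomorph.localInverseAt_symm _
  have he : e ∈ IsManifold.maximalAtlas 𝓘(ℂ, Fin n → ℂ) ω X :=
    IsManifold.subset_maximalAtlas hes
  refine ⟨{ toPartialEquiv := e.symm.toPartialEquiv
            open_source := e.open_target
            open_target := e.open_source
            contMDiffOn_toFun := contMDiffOn_symm_of_mem_maximalAtlas he
            contMDiffOn_invFun := contMDiffOn_of_mem_maximalAtlas he }, ?_, ?_⟩
  · exact hp.isCoveringMap.isLocalHomeomorph.self_mem_localInverseAt_target
  · intro y _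
    exact (congrFun hes y).symm

include hlin in
/-- The map `(z, v) ↦ z + v` commutes with the affine group action, hence descends to a holomorphic
map on the tangent bundle of the quotient; it is a dominating spray. -/
theorem IsQuotientCoveringMap.hasDominatingSpray_of_affine :
    letI := hp.isCoveringMap.isLocalHomeomorph.localInverseChartedSpace hp.surjective
    HasDominatingSpray n X := by
  let _ := hp.isCoveringMap.isLocalHomeomorph.localInverseChartedSpace hp.surjective
  have hM : IsManifold 𝓘(ℂ, Fin n → ℂ) ω X := hp.isManifold_of_affine lin hlin
  have hM1 : IsManifold 𝓘(ℂ, Fin n → ℂ) 1 X := .of_le (n := ω) le_top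
  have hM2 : IsManifold 𝓘(ℂ, Fin n → ℂ) (ω + 1) X := hM
  have hV : ContMDiffVectorBundle ω (Fin n → ℂ)
      (TangentSpace 𝓘(ℂ, Fin n → ℂ) : X → Type _) 𝓘(ℂ, Fin n → ℂ) :=
    TangentBundle.contMDiffVectorBundle
  have hsymm : ∀ x : X, ⇑(chartAt (Fin n → ℂ) x).symm = p := fun x =>
    hp.isCoveringMap.isLocalHomeomorph.localInverseAt_symm _
  have hld := hp.isLocalDiffeomorph_of_affine lin hlin
  let vec : TangentBundle 𝓘(ℂ, Fin n → ℂ) X → Fin n → ℂ := fun q => q.2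
  let s : TangentBundle 𝓘(ℂ, Fin n → ℂ) X → X := fun q =>
    p (chartAt (Fin n → ℂ) q.1 q.1 + vec q)
  -- in the trivialization around `x₀`, the spray is `(x, w) ↦ p (chart x + w)`
  have hs : ∀ (x₀ : X) (q : TangentBundle 𝓘(ℂ, Fin n → ℂ) X),
      q.1 ∈ (chartAt (Fin n → ℂ) x₀).source → s q = p (chartAt (Fin n → ℂ) x₀ q.1 +
        (trivializationAt (Fin n → ℂ) (TangentSpace 𝓘(ℂ, Fin n → ℂ)) x₀ q).2) := by
    intro x₀ q hq
    obtain ⟨g, hg⟩ := hp.exists_eventually_eq_smul (hsymm q.1) (hsymm x₀)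
      (mem_chart_source _ q.1) hq
    have hd : (trivializationAt (Fin n → ℂ) (TangentSpace 𝓘(ℂ, Fin n → ℂ)) x₀ q).2 =
        lin g (vec q) := by
      rw [TangentBundle.trivializationAt_apply]
      simp only [mfld_simps, fderivWithin_univ]
      have h1 : (chartAt (Fin n → ℂ) x₀ ∘ (chartAt (Fin n → ℂ) q.1).symm) =ᶠ[
          𝓝 (chartAt (Fin n → ℂ) q.1 q.1)] fun z => g • z := by
        have hc := (chartAt (Fin n → ℂ) q.1).symm.continuousAt
          (x := chartAt (Fin n → ℂ) q.1 q.1) (mem_chart_target _ _)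
        rw [ContinuousAt, (chartAt (Fin n → ℂ) q.1).left_inv (mem_chart_source _ _)] at hc
        filter_upwards [hc.eventually hg,
          (chartAt (Fin n → ℂ) q.1).open_target.mem_nhds (mem_chart_target _ _)] with y hy hyt
        rw [Function.comp_apply, hy, (chartAt (Fin n → ℂ) q.1).right_inv hyt]
      rw [((hasFDerivAt_smul_of_affine lin hlin g _).congr_of_eventuallyEq h1).fderiv]
    rw [hd, hg.self_of_nhds, ← hlin, hp.map_smul]
  refine ⟨n, TangentSpace 𝓘(ℂ, Fin n → ℂ), inferInstance, inferInstance, inferInstance,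
    inferInstance, inferInstance, inferInstance, hV, s, ?_, ?_, ?_⟩
  · intro q₀
    have hev : s =ᶠ[𝓝 q₀] fun q => p (chartAt (Fin n → ℂ) q₀.1 q.1 +
        (trivializationAt (Fin n → ℂ) (TangentSpace 𝓘(ℂ, Fin n → ℂ)) q₀.1 q).2) := by
      have hc : Continuous (TotalSpace.proj :
        TangentBundle 𝓘(ℂ, Fin n → ℂ) X → X) := FiberBundle.continuous_proj _ _
      filter_upwards [hc.continuousAt.preimage_mem_nhds
        ((chartAt (Fin n → ℂ) q₀.1).open_source.mem_nhds (mem_chart_source _ _))] with q hq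
      exact hs q₀.1 q hq
    refine ContMDiffAt.congr_of_eventuallyEq ?_ hev
    have h1 : ContMDiffAt (𝓘(ℂ, Fin n → ℂ).prod 𝓘(ℂ, Fin n → ℂ)) 𝓘(ℂ, Fin n → ℂ) ω
        (fun q : TangentBundle 𝓘(ℂ, Fin n → ℂ) X => chartAt (Fin n → ℂ) q₀.1 q.1) q₀ :=
      ContMDiffAt.comp q₀ (contMDiffAt_of_mem_maximalAtlas
        (IsManifold.chart_mem_maximalAtlas q₀.1) (mem_chart_source _ _))
        (Bundle.contMDiff_proj _ q₀)
    have h2 : ContMDiffAt (𝓘(ℂ, Fin n → ℂ).prod 𝓘(ℂ, Fin n → ℂ)) 𝓘(ℂ, Fin n → ℂ) ω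
        (fun q : TangentBundle 𝓘(ℂ, Fin n → ℂ) X =>
          (trivializationAt (Fin n → ℂ) (TangentSpace 𝓘(ℂ, Fin n → ℂ)) q₀.1 q).2) q₀ := by
      have := (trivializationAt (Fin n → ℂ) (TangentSpace 𝓘(ℂ, Fin n → ℂ)) q₀.1).contMDiffOn
        (n := ω) (IB := 𝓘(ℂ, Fin n → ℂ)) (𝕜 := ℂ)
      have h3 := this.contMDiffAt (x := q₀)
        ((trivializationAt (Fin n → ℂ) (TangentSpace 𝓘(ℂ, Fin n → ℂ)) q₀.1).open_source.mem_nhds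
          (FiberBundle.mem_trivializationAt_proj_source))
      exact contMDiffAt_snd.comp q₀ h3
    exact (hld.contMDiff _).comp q₀ (h1.add h2)
  · intro x
    change p (chartAt (Fin n → ℂ) x x + 0) = x
    rw [add_zero, ← hsymm x, (chartAt (Fin n → ℂ) x).left_inv (mem_chart_source _ _)]
  · intro x
    have hfun : (fun v : Fin n → ℂ => s ⟨x,
        (trivializationAt (Fin n → ℂ) (TangentSpace 𝓘(ℂ, Fin n → ℂ)) x).symm x v⟩) =
        p ∘ fun v => chartAt (Fin n → ℂ) x x + v := by
      funext v
      rw [hs x _ (mem_chart_source (Fin n → ℂ) x), Trivialization.apply_mk_symm]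
      · rfl
      · exact mem_chart_source _ _
    have ht : HasMFDerivAt 𝓘(ℂ, Fin n → ℂ) 𝓘(ℂ, Fin n → ℂ)
        (fun v : Fin n → ℂ => chartAt (Fin n → ℂ) x x + v) 0
        (ContinuousLinearMap.id ℂ (Fin n → ℂ)) :=
      ((hasFDerivAt_id (0 : Fin n → ℂ)).const_add _).hasMFDerivAt
    have hz := hld (chartAt (Fin n → ℂ) x x + 0)
    have hd := (hz.mdifferentiableAt (by simp)).hasMFDerivAt
    rw [hfun, (HasMFDerivAt.comp (0 : Fin n → ℂ) hd ht).mfderiv]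
    have hsurj := (hz.mfderivToContinuousLinearEquiv (by simp)).surjective
    intro w
    obtain ⟨u, hu⟩ := hsurj w
    exact ⟨u, hu⟩

end AffineQuotient

/-! ### Lorentzian geometry of the null cone -/

namespace MargulisExample

open Matrix

/-- The letters `a, b, a⁻¹, b⁻¹`: a generator and an exponent (`true` for `1`, `false` for `-1`). -/
abbrev Letter : Type := Bool × Bool

/-- The inverse letter. -/
def Letter.inv (s : Letter) : Letter := (s.1, !s.2)

theorem Letter.inv_inv (s : Letter) : s.inv.inv = s := by
  simp [Letter.inv]

/-- The exponent of a letter as a real sign. -/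
def sgn (b : Bool) : ℝ := if b then 1 else -1

/-- The Lorentz form `x₀ y₀ + x₁ y₁ - x₂ y₂`. -/
def lorentz (x y : Fin 3 → ℝ) : ℝ := x 0 * y 0 + x 1 * y 1 - x 2 * y 2

/-- The determinant with rows `u, p, q`. -/
def triple (u p q : Fin 3 → ℝ) : ℝ :=
  u 0 * (p 1 * q 2 - p 2 * q 1) - u 1 * (p 0 * q 2 - p 2 * q 0) + u 2 * (p 0 * q 1 - p 1 * q 0)

/-- The Lorentz product of `u` with the unit spacelike vector orthogonal to the null vectors `p`
and `q`, the sign of this vector being fixed by the orientation. It does not depend on the scaling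
of `p` and `q`. If `p` and `q` are the attracting and the repelling eigenvector of the linear part
of an affine isometry with translation part `u`, this is its Margulis invariant. -/
noncomputable def margulis (u p q : Fin 3 → ℝ) : ℝ := triple u p q / lorentz p q

/-- The coordinate singled out by a letter: `x₀, -x₀` for `a, a⁻¹` and `x₁, -x₁` for `b, b⁻¹`. -/
def dir (s : Letter) (v : Fin 3 → ℝ) : ℝ := sgn s.2 * (if s.1 then v 0 else v 1)

/-- The coordinate that vanishes in the direction of a letter. -/
def side (s : Letter) (v : Fin 3 → ℝ) : ℝ := if s.1 then v 1 else v 0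

/-- The future null vectors in the sector around the direction of the letter `s`. The four sectors
are pairwise disjoint. -/
def region (s : Letter) : Set (Fin 3 → ℝ) :=
  {v | lorentz v v = 0 ∧ 0 < v 2 ∧ 4 / 5 * v 2 ≤ dir s v}

theorem dir_inv (s : Letter) (v : Fin 3 → ℝ) : dir s.inv v = -dir s v := by
  rcases s with ⟨_ | _, _ | _⟩ <;> simp [dir, Letter.inv, sgn]

theorem lorentz_eq_dir_side (s : Letter) (v w : Fin 3 → ℝ) :
    lorentz v w = dir s v * dir s w + side s v * side s w - v 2 * w 2 := by
  rcases s with ⟨_ | _, _ | _⟩ <;> simp [dir, side, sgn, lorentz] <;> ring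

/-- The bound is the one on a null vector, as `(3/5)² = 1 - (4/5)²`. -/
theorem abs_side_le {s : Letter} {v : Fin 3 → ℝ} (hv : v ∈ region s) :
    |side s v| ≤ 3 / 5 * v 2 := by
  obtain ⟨h0, h1, h2⟩ := hv
  rw [lorentz_eq_dir_side s] at h0
  refine abs_le_of_sq_le_sq ?_ (by linarith)
  nlinarith

theorem dir_le {s r : Letter} (hsr : s ≠ r) {v : Fin 3 → ℝ} (hv : v ∈ region r) :
    dir s v ≤ 3 / 5 * v 2 := by
  have h := abs_le.mp (abs_side_le hv)
  obtain ⟨-, h1, h2⟩ := hv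
  rcases s with ⟨_ | _, _ | _⟩ <;> rcases r with ⟨_ | _, _ | _⟩ <;>
    first
    | exact absurd rfl hsr
    | (simp only [dir, side, sgn] at *; norm_num at *; linarith)

theorem abs_coord_le {v : Fin 3 → ℝ} (h0 : lorentz v v = 0) (h1 : 0 < v 2) (i : Fin 3) :
    |v i| ≤ v 2 := by
  unfold lorentz at h0
  refine abs_le_of_sq_le_sq ?_ h1.le
  fin_cases i <;> simp <;> nlinarith [sq_nonneg (v 0), sq_nonneg (v 1)]

/-- Null vectors in different sectors are uniformly far from being orthogonal. -/
theorem lorentz_le {s r : Letter} (hsr : s ≠ r) {p q : Fin 3 → ℝ} (hp : p ∈ region s)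
    (hq : q ∈ region r) : lorentz p q ≤ -(p 2 * q 2 / 50) := by
  have hd := dir_le hsr hq
  obtain ⟨hp0, hp1, hp2⟩ := hp
  obtain ⟨hq0, hq1, -⟩ := hq
  have hpq : 0 < p 2 * q 2 := mul_pos hp1 hq1
  have h1 : 1 / 5 * (p 2 * q 2) ≤ dir s p * q 2 - p 2 * dir s q := by nlinarith
  -- `2 p₂ q₂ (p₂ q₂ - p₀ q₀ - p₁ q₁)` is the squared length of `q₂ p - p₂ q`
  have h2 : (1 / 5 * (p 2 * q 2)) ^ 2 ≤ 2 * (p 2 * q 2) * -lorentz p q := by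
    have h3 : 2 * (p 2 * q 2) * -lorentz p q =
        (dir s p * q 2 - p 2 * dir s q) ^ 2 + (side s p * q 2 - p 2 * side s q) ^ 2 := by
      rw [lorentz_eq_dir_side s] at hp0 hq0 ⊢
      linear_combination (-q 2 ^ 2) * hp0 + (-p 2 ^ 2) * hq0
    rw [h3]
    have := pow_le_pow_left₀ (by positivity) h1 2
    nlinarith [sq_nonneg (side s p * q 2 - p 2 * side s q)]
  by_contra hcon
  push Not at hcon
  nlinarith

theorem neg_lorentz_le {p q : Fin 3 → ℝ} (hp : lorentz p p = 0) (hp2 : 0 < p 2)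
    (hq : lorentz q q = 0) (hq2 : 0 < q 2) : -lorentz p q ≤ 2 * (p 2 * q 2) := by
  unfold lorentz at *
  have h : (p 0 * q 0 + p 1 * q 1) ^ 2 ≤ (p 2 * q 2) ^ 2 := by
    nlinarith [sq_nonneg (p 0 * q 1 - p 1 * q 0)]
  have := abs_le.mp (abs_le_of_sq_le_sq h (mul_pos hp2 hq2).le)
  linarith [this.1]

theorem margulis_add (u v p q : Fin 3 → ℝ) :
    margulis (u + v) p q = margulis u p q + margulis v p q := by
  simp only [margulis, ← add_div]
  congr 1
  simp only [triple, Pi.add_apply]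
  ring

theorem abs_margulis_le {s r : Letter} (hsr : s ≠ r) {p q : Fin 3 → ℝ} (hp : p ∈ region s)
    (hq : q ∈ region r) {u : Fin 3 → ℝ} {R : ℝ} (hu : ∀ i, |u i| ≤ R) :
    |margulis u p q| ≤ 300 * R := by
  have hl := lorentz_le hsr hp hq
  have hpq : 0 < p 2 * q 2 := mul_pos hp.2.1 hq.2.1
  have hR : 0 ≤ R := (abs_nonneg _).trans (hu 0)
  have hprod : ∀ i j, |p i * q j| ≤ p 2 * q 2 := fun i j => by
    rw [abs_mul]
    exact mul_le_mul (abs_coord_le hp.1 hp.2.1 i) (abs_coord_le hq.1 hq.2.1 j) (abs_nonneg _)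
      hp.2.1.le
  have hterm : ∀ k i j i' j', |u k * (p i * q j - p i' * q j')| ≤ R * (2 * (p 2 * q 2)) := by
    intro k i j i' j'
    rw [abs_mul]
    refine mul_le_mul (hu k) ?_ (abs_nonneg _) hR
    have := abs_sub (p i * q j) (p i' * q j')
    linarith [hprod i j, hprod i' j']
  have htri : |triple u p q| ≤ 6 * R * (p 2 * q 2) := by
    have h0 := abs_le.mp (hterm 0 1 2 2 1)
    have h1 := abs_le.mp (hterm 1 0 2 2 0)
    have h2 := abs_le.mp (hterm 2 0 1 1 0)
    rw [triple, abs_le]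
    constructor <;> linarith [h0.1, h0.2, h1.1, h1.2, h2.1, h2.2]
  rw [margulis, abs_div, abs_of_neg (by linarith : lorentz p q < 0), div_le_iff₀ (by linarith)]
  nlinarith

/-! ### The generators -/

/-- A Lorentz boost in the `(x₀, x₂)`-plane or in the `(x₁, x₂)`-plane. -/
def boost (i : Bool) (c s : ℝ) : Matrix (Fin 3) (Fin 3) ℝ :=
  if i then !![c, 0, s; 0, 1, 0; s, 0, c] else !![1, 0, 0; 0, c, s; 0, s, c]

/-- The linear part of a letter. The entries `cosh t = 41/9` and `sinh t = 40/9` are chosen such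
that the complement of the sector of the inverse letter is mapped onto the sector of the letter. -/
noncomputable def letterMatrix (s : Letter) : Matrix (Fin 3) (Fin 3) ℝ :=
  boost s.1 (41 / 9) (sgn s.2 * (40 / 9))

/-- The translation part of a letter: a fixed vector of its linear part. -/
def letterTranslation (s : Letter) : Fin 3 → ℝ :=
  if s.1 then ![0, sgn s.2, 0] else ![-sgn s.2, 0, 0]

theorem boost_mulVec (i : Bool) (c s : ℝ) (v : Fin 3 → ℝ) :
    boost i c s *ᵥ v = if i then ![c * v 0 + s * v 2, v 1, s * v 0 + c * v 2]
      else ![v 0, c * v 1 + s * v 2, s * v 1 + c * v 2] := by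
  cases i <;> ext j <;> fin_cases j <;> simp [boost, mulVec, dotProduct, Fin.sum_univ_three]

theorem letterMatrix_mul_inv (s : Letter) : letterMatrix s * letterMatrix s.inv = 1 := by
  rcases s with ⟨_ | _, _ | _⟩ <;> ext i j <;> fin_cases i <;> fin_cases j <;>
    simp [letterMatrix, boost, Letter.inv, sgn, Matrix.mul_apply, Fin.sum_univ_three] <;> norm_num

theorem letterMatrix_inv_mul (s : Letter) : letterMatrix s.inv * letterMatrix s = 1 := by
  simpa [Letter.inv_inv] using letterMatrix_mul_inv s.inv

theorem lorentz_letterMatrix (s : Letter) (v w : Fin 3 → ℝ) :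
    lorentz (letterMatrix s *ᵥ v) (letterMatrix s *ᵥ w) = lorentz v w := by
  rcases s with ⟨_ | _, _ | _⟩ <;>
    simp [letterMatrix, boost_mulVec, sgn, lorentz] <;> ring

theorem triple_letterMatrix (s : Letter) (u v w : Fin 3 → ℝ) :
    triple (letterMatrix s *ᵥ u) (letterMatrix s *ᵥ v) (letterMatrix s *ᵥ w) = triple u v w := by
  rcases s with ⟨_ | _, _ | _⟩ <;>
    simp [letterMatrix, boost_mulVec, sgn, triple] <;> ring

theorem margulis_letterMatrix (s : Letter) (u v w : Fin 3 → ℝ) :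
    margulis (letterMatrix s *ᵥ u) (letterMatrix s *ᵥ v) w =
      margulis u v (letterMatrix s.inv *ᵥ w) := by
  have h : w = letterMatrix s *ᵥ (letterMatrix s.inv *ᵥ w) := by
    rw [mulVec_mulVec, letterMatrix_mul_inv, one_mulVec]
  conv_lhs => rw [h]
  rw [margulis, triple_letterMatrix, lorentz_letterMatrix, margulis]

theorem dir_letterMatrix (s : Letter) (v : Fin 3 → ℝ) :
    dir s (letterMatrix s *ᵥ v) = 41 / 9 * dir s v + 40 / 9 * v 2 := by
  rcases s with ⟨_ | _, _ | _⟩ <;> simp [letterMatrix, boost_mulVec, sgn, dir] <;> ring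

theorem letterMatrix_apply_two (s : Letter) (v : Fin 3 → ℝ) :
    (letterMatrix s *ᵥ v) 2 = 40 / 9 * dir s v + 41 / 9 * v 2 := by
  rcases s with ⟨_ | _, _ | _⟩ <;> simp [letterMatrix, boost_mulVec, sgn, dir]

theorem letterMatrix_apply_two_ge {s r : Letter} (hr : r ≠ s.inv) {v : Fin 3 → ℝ}
    (hv : v ∈ region r) : 17 / 9 * v 2 ≤ (letterMatrix s *ᵥ v) 2 := by
  have h := dir_le hr.symm hv
  rw [dir_inv] at h
  rw [letterMatrix_apply_two]
  linarith

theorem letterMatrix_mem_region {s r : Letter} (hr : r ≠ s.inv) {v : Fin 3 → ℝ}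
    (hv : v ∈ region r) : letterMatrix s *ᵥ v ∈ region s := by
  have h := dir_le hr.symm hv
  rw [dir_inv] at h
  have h1 := hv.2.1
  refine ⟨by rw [lorentz_letterMatrix]; exact hv.1, ?_, ?_⟩
  · linarith [letterMatrix_apply_two_ge hr hv]
  · rw [dir_letterMatrix, letterMatrix_apply_two]
    linarith

theorem triple_letterTranslation (s : Letter) (p q : Fin 3 → ℝ) :
    triple (letterTranslation s) p q = -(dir s p * q 2 - p 2 * dir s q) := by
  rcases s with ⟨_ | _, _ | _⟩ <;> simp [letterTranslation, sgn, triple, dir] <;> ring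

/-- The translation part of a letter contributes a definite amount to the Margulis invariant of
every word that starts with this letter. -/
theorem margulis_letterTranslation_ge {s r : Letter} (hsr : r ≠ s) {p q : Fin 3 → ℝ}
    (hp : p ∈ region s) (hq : q ∈ region r) :
    1 / 10 ≤ margulis (letterTranslation s) p q := by
  have hd := dir_le hsr.symm hq
  have hl := lorentz_le hsr.symm hp hq
  have hl2 := neg_lorentz_le hp.1 hp.2.1 hq.1 hq.2.1
  have hp2 := hp.2.2
  have hp1 := hp.2.1
  have hq1 := hq.2.1
  have hpq : 0 < p 2 * q 2 := mul_pos hp1 hq1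
  have h1 : 1 / 5 * (p 2 * q 2) ≤ dir s p * q 2 - p 2 * dir s q := by nlinarith
  rw [margulis, triple_letterTranslation, ← neg_neg (lorentz p q), neg_div_neg_eq,
    le_div_iff₀ (by linarith)]
  linarith

end MargulisExample

/-! ### The group and its words -/

namespace AffR3

theorem ext_linMatrix_translation {γ δ : AffR3} (h₁ : γ.linMatrix = δ.linMatrix)
    (h₂ : γ.translation = δ.translation) : γ = δ :=
  AffineEquiv.ext fun x => by rw [apply_eq, apply_eq, h₁, h₂]

end AffR3

namespace MargulisExample

open Matrix AffR3

/-- The affine transformation of a letter. -/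
noncomputable def letterAff (s : Letter) : AffR3 :=
  (LinearEquiv.ofLinearMap (Matrix.toLin' (letterMatrix s)) (Matrix.toLin' (letterMatrix s.inv))
    (by rw [← Matrix.toLin'_mul, letterMatrix_mul_inv, Matrix.toLin'_one])
    (by rw [← Matrix.toLin'_mul, letterMatrix_inv_mul, Matrix.toLin'_one])).toAffineEquiv.trans
      (AffineEquiv.constVAdd ℝ (Fin 3 → ℝ) (letterTranslation s))

theorem letterAff_apply (s : Letter) (x : Fin 3 → ℝ) :
    letterAff s x = letterMatrix s *ᵥ x + letterTranslation s := by
  simp [letterAff, add_comm]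

theorem translation_letterAff (s : Letter) : (letterAff s).translation = letterTranslation s := by
  rw [translation, letterAff_apply, mulVec_zero, zero_add]

theorem linMatrix_letterAff (s : Letter) : (letterAff s).linMatrix = letterMatrix s := by
  refine Matrix.mulVec_injective (funext fun x => ?_)
  have h := apply_eq (letterAff s) x
  rw [letterAff_apply, translation_letterAff] at h
  exact (add_right_cancel h).symm

theorem letterAff_mul_inv (s : Letter) : letterAff s * letterAff s.inv = 1 := by
  refine ext_linMatrix_translation ?_ ?_
  · rw [linMatrix_mul, linMatrix_letterAff, linMatrix_letterAff, letterMatrix_mul_inv,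
      linMatrix_one]
  · rw [translation_mul, linMatrix_letterAff, translation_letterAff, translation_letterAff]
    change _ = (0 : Fin 3 → ℝ)
    rcases s with ⟨_ | _, _ | _⟩ <;> ext j <;> fin_cases j <;>
      simp [letterMatrix, boost_mulVec, letterTranslation, sgn, Letter.inv]

/-- The action of words in the letters by affine transformations. -/
noncomputable def wordAff (L : List Letter) : AffR3 := (L.map letterAff).prod

theorem wordAff_cons (s : Letter) (L : List Letter) :
    wordAff (s :: L) = letterAff s * wordAff L := by
  simp [wordAff]

/-- The representation of the free group on two generators that defines the example. -/
noncomputable def rep : FreeGroup Bool →* AffR3 := FreeGroup.lift fun i => letterAff (i, true)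

theorem rep_mk (L : List Letter) : rep (FreeGroup.mk L) = wordAff L := by
  rw [rep, FreeGroup.lift_mk, wordAff]
  congr 1
  refine List.map_congr_left fun s _ => ?_
  rcases s with ⟨i, _ | _⟩
  · exact inv_eq_of_mul_eq_one_right (letterAff_mul_inv (i, true))
  · rfl

theorem rep_eq_wordAff (w : FreeGroup Bool) : rep w = wordAff w.toWord := by
  rw [← rep_mk, FreeGroup.mk_toWord]

theorem linMatrix_wordAff_cons (s : Letter) (L : List Letter) :
    (wordAff (s :: L)).linMatrix = letterMatrix s * (wordAff L).linMatrix := by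
  rw [wordAff_cons, linMatrix_mul, linMatrix_letterAff]

theorem translation_wordAff_cons (s : Letter) (L : List Letter) :
    (wordAff (s :: L)).translation =
      letterMatrix s *ᵥ (wordAff L).translation + letterTranslation s := by
  rw [wordAff_cons, translation_mul, linMatrix_letterAff, translation_letterAff]

theorem linMatrix_wordAff_nil : (wordAff []).linMatrix = 1 := linMatrix_one

theorem translation_wordAff_nil : (wordAff []).translation = 0 := rfl

/-! ### Ping-pong and the growth of the Margulis invariant -/

theorem ne_inv_of_isReduced {s r : Letter} {L : List Letter}
    (h : FreeGroup.IsReduced (s :: r :: L)) : r ≠ s.inv := by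
  rintro rfl
  have := (FreeGroup.isReduced_cons_cons.mp h).1 rfl
  simp [Letter.inv] at this

/-- A reduced word `L r` maps the sector of `r` into the sector of its first letter `s` under the
linear part of `L`, stretching the vectors exponentially. -/
theorem wordAff_mem_region {r : Letter} {p : Fin 3 → ℝ} (hp : p ∈ region r) (L : List Letter) :
    ∀ {s : Letter} {L' : List Letter}, L ++ [r] = s :: L' → FreeGroup.IsReduced (s :: L') →
      (wordAff L).linMatrix *ᵥ p ∈ region s ∧
        (17 / 9) ^ L.length * p 2 ≤ ((wordAff L).linMatrix *ᵥ p) 2 := by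
  induction L with
  | nil =>
    intro s L' h _
    obtain rfl : r = s := by simpa using congrArg List.head? h
    rw [linMatrix_wordAff_nil, one_mulVec]
    exact ⟨hp, by simp⟩
  | cons t L ih =>
    intro s L' h hred
    rw [List.cons_append] at h
    obtain ⟨rfl, rfl⟩ := List.cons.inj h
    obtain ⟨s', L'', h'⟩ := List.exists_cons_of_ne_nil (l := L ++ [r]) (by simp)
    rw [h'] at hred
    obtain ⟨h1, h2⟩ := ih h' (FreeGroup.isReduced_cons_cons.mp hred).2
    rw [linMatrix_wordAff_cons, ← mulVec_mulVec]
    have hne := ne_inv_of_isReduced hred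
    refine ⟨letterMatrix_mem_region hne h1, ?_⟩
    have h3 := letterMatrix_apply_two_ge hne h1
    rw [List.length_cons, pow_succ]
    linarith

/-- The Margulis invariant of the translation part grows linearly with the length of the word:
by invariance it is a sum over the letters of the word, in which the first letter contributes the
amount of `margulis_letterTranslation_ge`, and the others contribute likewise by induction. -/
theorem margulis_translation_wordAff_ge {r : Letter} {p : Fin 3 → ℝ} (hp : p ∈ region r)
    (L : List Letter) :
    ∀ {s : Letter} {L' : List Letter}, L ++ [r] = s :: L' → FreeGroup.IsReduced (s :: L') →
      ∀ {t : Letter} {q : Fin 3 → ℝ}, t ≠ s → q ∈ region t →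
        L.length / 10 ≤
          margulis (wordAff L).translation ((wordAff L).linMatrix *ᵥ p) q := by
  induction L with
  | nil =>
    intro s L' h _ t q hts hq
    simp [translation_wordAff_nil, margulis, triple]
  | cons u L ih =>
    intro s L' h hred t q hts hq
    have hmem := (wordAff_mem_region hp (u :: L) h hred).1
    rw [List.cons_append] at h
    obtain ⟨rfl, rfl⟩ := List.cons.inj h
    obtain ⟨s', L'', h'⟩ := List.exists_cons_of_ne_nil (l := L ++ [r]) (by simp)
    rw [h'] at hred
    have hne := ne_inv_of_isReduced hred
    have hq' : letterMatrix u.inv *ᵥ q ∈ region u.inv :=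
      letterMatrix_mem_region (by rwa [Letter.inv_inv]) hq
    have h1 := ih h' (FreeGroup.isReduced_cons_cons.mp hred).2 hne.symm hq'
    have h2 := margulis_letterTranslation_ge hts hmem hq
    rw [translation_wordAff_cons, margulis_add]
    rw [linMatrix_wordAff_cons, ← mulVec_mulVec] at h2 ⊢
    rw [margulis_letterMatrix, List.length_cons]
    push_cast
    linarith

/-- Pulling the word back by invariance moves the two null vectors into different sectors, where
`abs_margulis_le` applies. -/
theorem abs_margulis_wordAff_le {r : Letter} {p : Fin 3 → ℝ} (hp : p ∈ region r)
    {x : Fin 3 → ℝ} {R : ℝ} (hx : ∀ i, |x i| ≤ R) (L : List Letter) :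
    ∀ {s : Letter} {L' : List Letter}, L ++ [r] = s :: L' → FreeGroup.IsReduced (s :: L') →
      ∀ {t : Letter} {q : Fin 3 → ℝ}, t ≠ s → q ∈ region t →
        |margulis ((wordAff L).linMatrix *ᵥ x) ((wordAff L).linMatrix *ᵥ p) q| ≤ 300 * R := by
  induction L with
  | nil =>
    intro s L' h _ t q hts hq
    obtain rfl : r = s := by simpa using congrArg List.head? h
    rw [linMatrix_wordAff_nil, one_mulVec, one_mulVec]
    exact abs_margulis_le hts.symm hp hq hx
  | cons u L ih =>
    intro s L' h hred t q hts hq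
    rw [List.cons_append] at h
    obtain ⟨rfl, rfl⟩ := List.cons.inj h
    obtain ⟨s', L'', h'⟩ := List.exists_cons_of_ne_nil (l := L ++ [r]) (by simp)
    rw [h'] at hred
    have hne := ne_inv_of_isReduced hred
    have hq' : letterMatrix u.inv *ᵥ q ∈ region u.inv :=
      letterMatrix_mem_region (by rwa [Letter.inv_inv]) hq
    rw [linMatrix_wordAff_cons, ← mulVec_mulVec, ← mulVec_mulVec, margulis_letterMatrix]
    exact ih h' (FreeGroup.isReduced_cons_cons.mp hred).2 hne.symm hq'

/-! ### Eigenvectors and hyperbolicity -/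

/-- A null vector in the direction of `s`, normalized to have last coordinate `1`, with coordinate
`y` to the side. -/
noncomputable def sectorVec (s : Letter) (y : ℝ) : Fin 3 → ℝ :=
  if s.1 then ![sgn s.2 * √(1 - y ^ 2), y, 1] else ![y, sgn s.2 * √(1 - y ^ 2), 1]

theorem dir_sectorVec (s : Letter) (y : ℝ) : dir s (sectorVec s y) = √(1 - y ^ 2) := by
  rcases s with ⟨_ | _, _ | _⟩ <;> simp [dir, sectorVec, sgn]

theorem side_sectorVec (s : Letter) (y : ℝ) : side s (sectorVec s y) = y := by
  rcases s with ⟨_ | _, _ | _⟩ <;> simp [side, sectorVec]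

theorem sectorVec_two (s : Letter) (y : ℝ) : sectorVec s y 2 = 1 := by
  rcases s with ⟨_ | _, _ | _⟩ <;> simp [sectorVec]

theorem sectorVec_mem_region (s : Letter) {y : ℝ} (hy : y ∈ Set.Icc (-(3 / 5) : ℝ) (3 / 5)) :
    sectorVec s y ∈ region s := by
  have h : (4 / 5 : ℝ) ^ 2 ≤ 1 - y ^ 2 := by nlinarith [hy.1, hy.2]
  refine ⟨?_, by simp [sectorVec_two], ?_⟩
  · rw [lorentz_eq_dir_side s, dir_sectorVec, side_sectorVec, sectorVec_two,
      Real.mul_self_sqrt (by nlinarith)]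
    ring
  · rw [dir_sectorVec, sectorVec_two, mul_one]
    exact Real.le_sqrt_of_sq_le h

theorem eq_smul_sectorVec {s : Letter} {v : Fin 3 → ℝ} (hv : v ∈ region s) {y : ℝ}
    (hy : side s v = y * v 2) : v = v 2 • sectorVec s y := by
  obtain ⟨h0, h1, h2⟩ := hv
  have hd : dir s v = √(1 - y ^ 2) * v 2 := by
    rw [lorentz_eq_dir_side s, hy] at h0
    have h3 : 1 - y ^ 2 = (dir s v / v 2) ^ 2 := by
      field_simp
      linarith
    rw [h3, Real.sqrt_sq (div_nonneg (by linarith) h1.le)]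
    field_simp
  rcases s with ⟨_ | _, _ | _⟩ <;> simp only [dir, side, sgn] at hd hy <;> ext j <;>
    fin_cases j <;> simp [sectorVec, sgn] at * <;> linarith

/-- A linear map that preserves a sector has an eigenvector there, by the intermediate value
theorem on the projectivized sector. -/
theorem exists_eigenvector_of_mapsTo_region {s : Letter} {A : Matrix (Fin 3) (Fin 3) ℝ}
    (hA : ∀ v ∈ region s, A *ᵥ v ∈ region s) : ∃ v ∈ region s, ∃ l : ℝ, A *ᵥ v = l • v := by
  have hcont : Continuous fun y => A *ᵥ sectorVec s y := by
    refine Continuous.matrix_mulVec continuous_const ?_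
    refine continuous_pi fun j => ?_
    rcases s with ⟨_ | _, _⟩ <;> fin_cases j <;> simp [sectorVec] <;> fun_prop
  have hside : Continuous fun v => side s v := by
    rcases s with ⟨_ | _, _⟩ <;> simp [side] <;> fun_prop
  have hpos : ∀ y ∈ Set.Icc (-(3 / 5) : ℝ) (3 / 5), 0 < (A *ᵥ sectorVec s y) 2 := fun y hy =>
    (hA _ (sectorVec_mem_region s hy)).2.1
  obtain ⟨y, hy, hfix⟩ := exists_mem_Icc_isFixedPt_of_mapsTo
    (a := (-(3 / 5) : ℝ)) (b := 3 / 5)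
    (f := fun y => side s (A *ᵥ sectorVec s y) / (A *ᵥ sectorVec s y) 2)
    ((hside.comp hcont).continuousOn.div ((continuous_apply 2).comp hcont).continuousOn
      fun y hy => (hpos y hy).ne') (by norm_num) (by
      intro y hy
      have h := abs_le.mp (abs_side_le (hA _ (sectorVec_mem_region s hy)))
      have h2 := hpos y hy
      exact ⟨by rw [le_div_iff₀ h2]; linarith, by rw [div_le_iff₀ h2]; linarith⟩)
  refine ⟨sectorVec s y, sectorVec_mem_region s hy, _,
    eq_smul_sectorVec (hA _ (sectorVec_mem_region s hy)) ?_⟩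
  exact (div_eq_iff (hpos y hy).ne').mp hfix

theorem hasEigenvalue_iff_det {A : Matrix (Fin 3) (Fin 3) ℝ} {l : ℝ} :
    Module.End.HasEigenvalue (Matrix.toLin' A) l ↔
      (A - l • (1 : Matrix (Fin 3) (Fin 3) ℝ)).det = 0 := by
  rw [← Matrix.exists_mulVec_eq_zero_iff]
  constructor
  · intro h
    obtain ⟨v, hv⟩ := h.exists_hasEigenvector
    refine ⟨v, hv.2, ?_⟩
    have := hv.apply_eq_smul
    rw [Matrix.toLin'_apply] at this
    rw [sub_mulVec, this, smul_mulVec, one_mulVec, sub_self]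
  · rintro ⟨v, hv0, hv⟩
    refine Module.End.hasEigenvalue_of_hasEigenvector (x := v) ⟨?_, hv0⟩
    rw [Module.End.mem_eigenspace_iff, Matrix.toLin'_apply]
    rw [sub_mulVec, smul_mulVec, one_mulVec, sub_eq_zero] at hv
    exact hv

/-- An isometry of the Lorentz form is conjugate to the inverse of its transpose, so the
characteristic polynomial is palindromic up to sign. -/
theorem det_sub_smul_eq_of_mem_SO21 {A : Matrix (Fin 3) (Fin 3) ℝ} (hA : A ∈ SO21) (l : ℝ) :
    (A - l • (1 : Matrix (Fin 3) (Fin 3) ℝ)).det =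
      ((1 : Matrix (Fin 3) (Fin 3) ℝ) - l • A).det := by
  obtain ⟨h1, h2⟩ := hA
  have hJ : (Matrix.diagonal ![1, 1, -1] : Matrix (Fin 3) (Fin 3) ℝ).det = -1 := by
    rw [Matrix.det_diagonal]
    simp [Fin.prod_univ_three]
  have h3 : Aᵀ * Matrix.diagonal ![1, 1, -1] * (A - l • (1 : Matrix (Fin 3) (Fin 3) ℝ)) =
      ((1 : Matrix (Fin 3) (Fin 3) ℝ) - l • A)ᵀ * Matrix.diagonal ![1, 1, -1] := by
    rw [Matrix.mul_sub, h1, Matrix.transpose_sub, Matrix.sub_mul, Matrix.transpose_one,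
      Matrix.one_mul, Matrix.mul_smul, Matrix.mul_one, Matrix.transpose_smul, Matrix.smul_mul]
  have h4 := congrArg Matrix.det h3
  rw [Matrix.det_mul, Matrix.det_mul, Matrix.det_mul, Matrix.det_transpose, Matrix.det_transpose,
    hJ, h2] at h4
  linarith

theorem hasEigenvalue_one_of_mem_SO21 {A : Matrix (Fin 3) (Fin 3) ℝ} (hA : A ∈ SO21) :
    Module.End.HasEigenvalue (Matrix.toLin' A) 1 := by
  rw [hasEigenvalue_iff_det]
  have h := det_sub_smul_eq_of_mem_SO21 hA 1
  -- the dimension is odd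
  have h2 : ((1 : Matrix (Fin 3) (Fin 3) ℝ) - (1 : ℝ) • A).det =
      -(A - (1 : ℝ) • (1 : Matrix (Fin 3) (Fin 3) ℝ)).det := by
    rw [one_smul, one_smul, ← neg_sub, Matrix.det_neg, Fintype.card_fin]
    ring
  linarith

theorem hasEigenvalue_inv_of_mem_SO21 {A : Matrix (Fin 3) (Fin 3) ℝ} (hA : A ∈ SO21) {l : ℝ}
    (hl : l ≠ 0) (h : Module.End.HasEigenvalue (Matrix.toLin' A) l) :
    Module.End.HasEigenvalue (Matrix.toLin' A) l⁻¹ := by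
  rw [hasEigenvalue_iff_det] at h ⊢
  rw [det_sub_smul_eq_of_mem_SO21 hA] at h
  have h2 : (1 : Matrix (Fin 3) (Fin 3) ℝ) - l • A = (-l) • (A - l⁻¹ • 1) := by
    rw [smul_sub, smul_smul, neg_mul, mul_inv_cancel₀ hl]
    simp [sub_eq_add_neg, add_comm]
  rw [h2, Matrix.det_smul] at h
  exact (mul_eq_zero.mp h).resolve_left (pow_ne_zero _ (neg_ne_zero.mpr hl))

/-- An element of `SO⁰(2,1)` with an eigenvalue `l > 1` has the eigenvalues `l, 1, l⁻¹`. -/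
theorem isHyperbolicSO21_of_eigenvalue {A : Matrix (Fin 3) (Fin 3) ℝ} (hA : A ∈ SO21Identity)
    {l : ℝ} (hl : 1 < l) (h : Module.End.HasEigenvalue (Matrix.toLin' A) l) :
    IsHyperbolicSO21 A := by
  have hA' : A ∈ SO21 := connectedComponentIn_subset _ _ hA
  have h1 : l⁻¹ < 1 := inv_lt_one_of_one_lt₀ hl
  refine ⟨hA, ![l, 1, l⁻¹], ?_, ?_⟩
  · intro i j hij
    fin_cases i <;> fin_cases j <;> simp at hij ⊢ <;> linarith
  · intro i
    fin_cases i
    · exact h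
    · exact hasEigenvalue_one_of_mem_SO21 hA'
    · exact hasEigenvalue_inv_of_mem_SO21 hA' (by linarith) h

theorem ne_one_of_isHyperbolicSO21 {A : Matrix (Fin 3) (Fin 3) ℝ} (hA : IsHyperbolicSO21 A) :
    A ≠ 1 := by
  rintro rfl
  obtain ⟨-, l, hinj, hl⟩ := hA
  have h : ∀ i, l i = 1 := fun i => by
    obtain ⟨v, hv⟩ := (hl i).exists_hasEigenvector
    have h1 := hv.apply_eq_smul
    rw [Matrix.toLin'_apply, one_mulVec] at h1
    by_contra hne
    have h2 : (1 - l i) • v = 0 := by rw [sub_smul, one_smul, ← h1, sub_self]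
    exact hv.2 ((smul_eq_zero.mp h2).resolve_left (sub_ne_zero.mpr (Ne.symm hne)))
  exact absurd (hinj ((h 0).trans (h 1).symm)) (by decide)

theorem mul_mem_SO21 {A B : Matrix (Fin 3) (Fin 3) ℝ} (hA : A ∈ SO21) (hB : B ∈ SO21) :
    A * B ∈ SO21 := by
  refine ⟨?_, by rw [Matrix.det_mul, hA.2, hB.2, mul_one]⟩
  calc (A * B)ᵀ * Matrix.diagonal ![1, 1, -1] * (A * B)
      = Bᵀ * (Aᵀ * Matrix.diagonal ![1, 1, -1] * A) * B := by
        simp only [Matrix.transpose_mul, Matrix.mul_assoc]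
    _ = _ := by rw [hA.1, hB.1]

theorem boost_mem_SO21 (i : Bool) {c s : ℝ} (h : c ^ 2 - s ^ 2 = 1) : boost i c s ∈ SO21 := by
  constructor
  · cases i <;> ext j k <;> fin_cases j <;> fin_cases k <;>
      simp [boost, Matrix.mul_apply, Fin.sum_univ_three, Matrix.diagonal] <;> linarith
  · cases i <;> simp [boost, Matrix.det_fin_three] <;> linarith

/-- Boosts can be deformed to the identity, so they preserve the identity component. -/
theorem letterMatrix_mul_mem_SO21Identity (s : Letter) {A : Matrix (Fin 3) (Fin 3) ℝ}
    (hA : A ∈ SO21Identity) : letterMatrix s * A ∈ SO21Identity := by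
  have hA' : A ∈ SO21 := connectedComponentIn_subset _ _ hA
  let f : ℝ → Matrix (Fin 3) (Fin 3) ℝ := fun t => boost s.1 (Real.cosh t) (Real.sinh t) * A
  have hf : Continuous f := by
    refine Continuous.matrix_mul ?_ continuous_const
    refine continuous_matrix fun j k => ?_
    rcases s with ⟨_ | _, _⟩ <;> fin_cases j <;> fin_cases k <;> simp [boost] <;> fun_prop
  have h0 : f 0 = A := by
    have : boost s.1 1 0 = 1 := by
      rcases s with ⟨_ | _, _⟩ <;> ext j k <;> fin_cases j <;> fin_cases k <;> simp [boost]
    simp [f, this]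
  have h1 : f (Real.arsinh (sgn s.2 * (40 / 9))) = letterMatrix s * A := by
    have : Real.cosh (Real.arsinh (sgn s.2 * (40 / 9))) = 41 / 9 := by
      rw [Real.cosh_arsinh, Real.sqrt_eq_iff_mul_self_eq (by positivity) (by norm_num)]
      rcases s with ⟨_, _ | _⟩ <;> norm_num [sgn]
    simp only [f, this, Real.sinh_arsinh, letterMatrix]
  have hsub : Set.range f ⊆ connectedComponentIn SO21 A :=
    (isPreconnected_range hf).subset_connectedComponentIn ⟨0, h0⟩ (by
      rintro _ ⟨t, rfl⟩
      exact mul_mem_SO21 (boost_mem_SO21 _ (Real.cosh_sq_sub_sinh_sq t)) hA')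
  rw [SO21Identity, connectedComponentIn_eq hA]
  exact hsub ⟨_, h1⟩

theorem linMatrix_wordAff_mem_SO21Identity (L : List Letter) :
    (wordAff L).linMatrix ∈ SO21Identity := by
  induction L with
  | nil =>
    rw [linMatrix_wordAff_nil]
    exact mem_connectedComponentIn ⟨by simp, by simp⟩
  | cons s L ih =>
    rw [linMatrix_wordAff_cons]
    exact letterMatrix_mul_mem_SO21Identity s ih

/-- The linear part of a cyclically reduced word maps the sector of its first letter into itself,
and stretches the eigenvector found there. -/
theorem exists_eigenvalue_of_isCyclicallyReduced {L : List Letter} (hne : L ≠ [])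
    (hL : FreeGroup.IsCyclicallyReduced L) :
    ∃ l : ℝ, 1 < l ∧ Module.End.HasEigenvalue (Matrix.toLin' (wordAff L).linMatrix) l := by
  obtain ⟨s, L', rfl⟩ := List.exists_cons_of_ne_nil hne
  have hred : FreeGroup.IsReduced (s :: (L' ++ [s])) := by
    have := List.isChain_append.mpr ⟨hL.1, List.isChain_singleton s, fun a ha b hb => by
      obtain rfl : s = b := by simpa using hb
      exact hL.2 a ha s (by simp)⟩
    exact this
  obtain ⟨v, hv, l, hl⟩ := exists_eigenvector_of_mapsTo_region
    fun v hv => (wordAff_mem_region hv (s :: L') rfl hred).1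
  have h2 := (wordAff_mem_region hv (s :: L') rfl hred).2
  have hv2 := hv.2.1
  refine ⟨l, ?_, Module.End.hasEigenvalue_of_hasEigenvector (x := v) ⟨?_, ?_⟩⟩
  · rw [hl, Pi.smul_apply, smul_eq_mul] at h2
    have h3 : (1 : ℝ) < (17 / 9) ^ (s :: L').length := one_lt_pow₀ (by norm_num) (by simp)
    exact h3.trans_le (le_of_mul_le_mul_right h2 hv2)
  · rw [Module.End.mem_eigenspace_iff, Matrix.toLin'_apply, hl]
  · rintro rfl
    simp at hv2

theorem hasEigenvalue_linMatrix_conj {γ δ : AffR3} {l : ℝ}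
    (h : Module.End.HasEigenvalue (Matrix.toLin' γ.linMatrix) l) :
    Module.End.HasEigenvalue (Matrix.toLin' (δ * γ * δ⁻¹).linMatrix) l := by
  have hinv : δ.linMatrix * δ⁻¹.linMatrix = 1 := by
    rw [← linMatrix_mul, mul_inv_cancel, linMatrix_one]
  have hinv' : δ⁻¹.linMatrix * δ.linMatrix = 1 := by
    rw [← linMatrix_mul, inv_mul_cancel, linMatrix_one]
  rw [hasEigenvalue_iff_det] at h ⊢
  have h1 : (δ * γ * δ⁻¹).linMatrix - l • (1 : Matrix (Fin 3) (Fin 3) ℝ) =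
      δ.linMatrix * (γ.linMatrix - l • 1) * δ⁻¹.linMatrix := by
    rw [linMatrix_mul, linMatrix_mul, Matrix.mul_sub, Matrix.sub_mul, Matrix.mul_smul,
      Matrix.mul_one, Matrix.smul_mul, hinv]
  rw [h1, Matrix.det_mul, Matrix.det_mul, h, mul_zero, zero_mul]

theorem isHyperbolicSO21_rep {w : FreeGroup Bool} (hw : w ≠ 1) :
    IsHyperbolicSO21 (rep w).linMatrix := by
  let R := FreeGroup.reduceCyclically w.toWord
  let C := FreeGroup.reduceCyclically.conjugator w.toWord
  have hconj : w = FreeGroup.mk C * FreeGroup.mk R * (FreeGroup.mk C)⁻¹ := by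
    rw [FreeGroup.inv_mk, FreeGroup.mul_mk, FreeGroup.mul_mk,
      FreeGroup.reduceCyclically.conj_conjugator_reduceCyclically, FreeGroup.mk_toWord]
  have hR : R ≠ [] := by
    intro h
    rw [h] at hconj
    apply hw
    rw [hconj, ← FreeGroup.one_eq_mk]
    group
  obtain ⟨l, hl, hev⟩ := exists_eigenvalue_of_isCyclicallyReduced hR
    (FreeGroup.reduceCyclically.isCyclicallyReduced FreeGroup.isReduced_toWord)
  refine isHyperbolicSO21_of_eigenvalue ?_ hl ?_
  · rw [rep_eq_wordAff]
    exact linMatrix_wordAff_mem_SO21Identity _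
  · rw [hconj, map_mul, map_mul, map_inv, rep_mk, rep_mk]
    exact hasEigenvalue_linMatrix_conj hev

theorem rep_injective : Function.Injective rep := by
  rw [injective_iff_map_eq_one]
  intro w hw
  by_contra hne
  refine ne_one_of_isHyperbolicSO21 (isHyperbolicSO21_rep hne) ?_
  rw [hw, linMatrix_one]

/-! ### Proper discontinuity -/

theorem sectorVec_zero_mem_region (s : Letter) : sectorVec s 0 ∈ region s :=
  sectorVec_mem_region s (by norm_num)

/-- If `w` moves a point of the cube `[-R, R]³` into this cube, then its length is bounded: the
Margulis invariant of the displacement is bounded, but it grows with the length of `w`. -/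
theorem length_toWord_le {w : FreeGroup Bool} {x : Fin 3 → ℝ} {R : ℝ} (hx : ∀ i, |x i| ≤ R)
    (hy : ∀ i, |(rep w) x i| ≤ R) : (w.toWord.length : ℝ) ≤ 6000 * R := by
  rw [rep_eq_wordAff] at hy
  have hred : FreeGroup.IsReduced w.toWord := FreeGroup.isReduced_toWord
  generalize w.toWord = L at *
  have hR : 0 ≤ R := (abs_nonneg _).trans (hx 0)
  -- the word stays reduced when its last letter is repeated
  rcases List.eq_nil_or_concat L with rfl | ⟨L₀, r, rfl⟩
  · simpa using hR
  rw [List.concat_eq_append] at *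
  have hred' : FreeGroup.IsReduced (L₀ ++ [r] ++ [r]) :=
    List.isChain_append.mpr ⟨hred, List.isChain_singleton r, fun a ha b hb => by
      obtain rfl : r = a := by simpa using ha
      obtain rfl : r = b := by simpa using hb
      exact fun _ => rfl⟩
  obtain ⟨s, L', h⟩ := List.exists_cons_of_ne_nil (l := L₀ ++ [r] ++ [r]) (by simp)
  -- the null vectors lie in the sector of the last letter and in that of the inverse first letter
  have hs : Letter.inv s ≠ s := fun h => by
    simpa [Letter.inv] using congrArg Prod.snd h
  have hred'' := hred'
  rw [h] at hred''
  have hp := sectorVec_zero_mem_region r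
  have hq := sectorVec_zero_mem_region (Letter.inv s)
  have h1 := margulis_translation_wordAff_ge hp _ h hred'' hs hq
  have h2 := abs_margulis_wordAff_le hp hx _ h hred'' hs hq
  have h3 := abs_margulis_le hs.symm (wordAff_mem_region hp _ h hred'').1 hq hy
  rw [AffR3.apply_eq, margulis_add] at h3
  linarith [(abs_le.mp h2).1, (abs_le.mp h3).2]

/-- The group generated by the two affine transformations. -/
noncomputable def margulisGroup : Subgroup AffR3 := rep.range

theorem properlyDiscontinuousSMul_real :
    ProperlyDiscontinuousSMul margulisGroup (Fin 3 → ℝ) := by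
  refine ⟨fun {K L} hK hL => ?_⟩
  obtain ⟨R, hR⟩ := (hK.union hL).isBounded.exists_norm_le
  have hfin : {w : FreeGroup Bool | (w.toWord.length : ℝ) ≤ 6000 * R}.Finite := by
    have h1 : {l : List Letter | l.length ≤ ⌊6000 * R⌋₊}.Finite := List.finite_length_le _ _
    refine (h1.preimage FreeGroup.toWord_injective.injOn).subset fun w hw => ?_
    exact Nat.le_floor hw
  refine (hfin.image fun w => (⟨rep w, w, rfl⟩ : margulisGroup)).subset ?_
  rintro ⟨_, w, rfl⟩ ⟨_, ⟨x, hx, rfl⟩, hy⟩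
  refine ⟨w, ?_, rfl⟩
  exact length_toWord_le (fun i => (norm_le_pi_norm x i).trans (hR x (Or.inl hx)))
    fun i => (norm_le_pi_norm (rep w x) i).trans (hR _ (Or.inr hy))

theorem re_smul (γ : AffR3) (z : Fin 3 → ℂ) :
    (fun i => ((γ • z) i).re) = γ • fun i => (z i).re := by
  funext i
  rw [smul_complex_def, smul_real_def, apply_eq]
  simp [mulVec, dotProduct]

/-- The real part is an equivariant map from `ℂ³` to `ℝ³`, so proper discontinuity on `ℂ³` follows
from that on `ℝ³`. -/
theorem properlyDiscontinuousSMul_complex :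
    ProperlyDiscontinuousSMul margulisGroup (Fin 3 → ℂ) := by
  have hre : Continuous fun (z : Fin 3 → ℂ) i => (z i).re := by fun_prop
  have := properlyDiscontinuousSMul_real
  refine ⟨fun {K L} hK hL => ?_⟩
  refine (finite_disjoint_inter_image (Γ := margulisGroup) (hK.image hre)
    (hL.image hre)).subset ?_
  rintro γ ⟨_, ⟨z, hz, rfl⟩, hw⟩
  exact ⟨_, ⟨_, ⟨z, hz, rfl⟩, rfl⟩, ⟨_, hw, re_smul γ.1 z⟩⟩

/-- Point stabilizers are finite, hence trivial, as free groups are torsion-free. -/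
theorem smul_real_ne (γ : margulisGroup) (hγ : γ ≠ 1) (x : Fin 3 → ℝ) : γ • x ≠ x := by
  intro hfix
  have := properlyDiscontinuousSMul_real
  have hfin := ProperlyDiscontinuousSMul.finite_stabilizer (Γ := margulisGroup) x
  have hmem : γ ∈ MulAction.stabilizer margulisGroup x := hfix
  have e : FreeGroup Bool ≃* margulisGroup := MonoidHom.ofInjective rep_injective
  have htf : IsMulTorsionFree margulisGroup :=
    Function.Injective.isMulTorsionFree e.symm.toMonoidHom e.symm.injective
  have hinj : Function.Injective fun n : ℕ => γ ^ n := IsMulTorsionFree.pow_right_injective hγ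
  exact Set.infinite_of_injective_forall_mem hinj (fun n => pow_mem hmem n) hfin

theorem smul_complex_ne (γ : margulisGroup) (hγ : γ ≠ 1) (z : Fin 3 → ℂ) : γ • z ≠ z := by
  intro h
  refine smul_real_ne γ hγ (fun i => (z i).re) ?_
  have h1 := re_smul γ.1 z
  change γ.1 • z = z at h
  rw [h] at h1
  exact h1.symm

theorem nonempty_mulEquiv_freeGroupOfRank_two :
    Nonempty (margulisGroup ≃* FreeGroupOfRank 2) := by
  let e : {i : ℕ // (i : ℕ∞) < 2} ≃ Bool := by
    refine Equiv.symm (Equiv.ofBijective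
      (fun b : Bool => ⟨b.toNat, by cases b <;> norm_num⟩) ⟨?_, ?_⟩)
    · intro a b h
      cases a <;> cases b <;> simp at h ⊢
    · rintro ⟨i, hi⟩
      have : i < 2 := by exact_mod_cast hi
      interval_cases i
      · exact ⟨false, rfl⟩
      · exact ⟨true, rfl⟩
  exact ⟨(MonoidHom.ofInjective rep_injective).symm.trans (FreeGroup.freeGroupCongr e).symm⟩

theorem isMargulisGroup : IsMargulisGroup margulisGroup where
  free_rank_two := nonempty_mulEquiv_freeGroupOfRank_two
  acts_freely := smul_real_ne
  properlyDiscontinuous := properlyDiscontinuousSMul_real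
  hyperbolic := by
    rintro _ ⟨w, rfl⟩ hw
    exact isHyperbolicSO21_rep fun h => hw (by rw [h, map_one])

end MargulisExample

/-! ### The quotient manifolds -/

/-- The linear part of an affine automorphism of `ℝ³`, acting on `ℂ³`. -/
noncomputable def AffR3.complexLinear (γ : AffR3) : (Fin 3 → ℂ) →L[ℂ] (Fin 3 → ℂ) :=
  LinearMap.toContinuousLinearMap (Matrix.toLin' (γ.linMatrix.map Complex.ofReal))

theorem AffR3.smul_add_complex (γ : AffR3) (z v : Fin 3 → ℂ) :
    γ • (z + v) = γ • z + γ.complexLinear v := by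
  rw [smul_complex_def, smul_complex_def, Matrix.mulVec_add]
  change _ = _ + (γ.linMatrix.map Complex.ofReal).mulVec v
  abel

/-- There is a group `Γ` of affine automorphisms as in Margulis's example, acting freely and
properly discontinuously on `ℂ³`, such that for every `k ∈ ℕ ∪ {ℵ₀}` there is a subgroup `Γ'` of `Γ`
that is free of rank `k`, and `S = ℂ³/Γ'`, with the complex structure for which the projection
`ℂ³ → S` is locally biholomorphic, is a 3-dimensional elliptic manifold with `π₁(S) ≅ F_k` and
`πₙ(S) = 0` for `n > 1`. -/
theorem mainTheorem4 :
    ∃ Γ : Subgroup AffR3, IsMargulisGroup Γ ∧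
      (∀ γ : Γ, γ ≠ 1 → ∀ z : Fin 3 → ℂ, γ • z ≠ z) ∧
      ProperlyDiscontinuousSMul Γ (Fin 3 → ℂ) ∧
      ∀ k : ℕ∞, ∃ Γ' : Subgroup AffR3, Γ' ≤ Γ ∧ Nonempty (Γ' ≃* FreeGroupOfRank k) ∧
        ∃ _ : ChartedSpace (Fin 3 → ℂ) (ComplexQuotient Γ'),
          IsLocalDiffeomorph 𝓘(ℂ, Fin 3 → ℂ) 𝓘(ℂ, Fin 3 → ℂ) ω (ComplexQuotient.proj Γ') ∧
          IsEllipticManifold 3 (ComplexQuotient Γ') ∧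
          (∀ x : ComplexQuotient Γ',
            Nonempty (FundamentalGroup (ComplexQuotient Γ') x ≃* FreeGroupOfRank k)) ∧
          ∀ n : ℕ, 1 < n → ∀ x : ComplexQuotient Γ',
            Subsingleton (HomotopyGroup.Pi n (ComplexQuotient Γ') x) := by
  refine ⟨MargulisExample.margulisGroup, MargulisExample.isMargulisGroup,
    MargulisExample.smul_complex_ne, MargulisExample.properlyDiscontinuousSMul_complex,
    fun k => ?_⟩
  obtain ⟨e₂⟩ := MargulisExample.nonempty_mulEquiv_freeGroupOfRank_two
  obtain ⟨H, ⟨e⟩⟩ := exists_subgroup_mulEquiv_freeGroupOfRank e₂ k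
  have hle : H.map MargulisExample.margulisGroup.subtype ≤ MargulisExample.margulisGroup :=
    Subgroup.map_subtype_le H
  have e' : H.map MargulisExample.margulisGroup.subtype ≃* FreeGroupOfRank k :=
    (H.equivMapOfInjective _ Subtype.val_injective).symm.trans e
  generalize H.map MargulisExample.margulisGroup.subtype = Γ' at hle e'
  have hpd : ProperlyDiscontinuousSMul Γ' (Fin 3 → ℂ) := by
    have := MargulisExample.properlyDiscontinuousSMul_complex
    refine ⟨fun {K L} hK hL => ?_⟩
    refine ((finite_disjoint_inter_image (Γ := MargulisExample.margulisGroup) hK hL).preimage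
      (Subgroup.inclusion_injective hle).injOn).subset ?_
    exact fun γ hγ => hγ
  have hcont : ContinuousConstSMul Γ' (Fin 3 → ℂ) := by
    refine ⟨fun γ => ?_⟩
    have h : (fun z : Fin 3 → ℂ => γ • z) =
        fun z => γ.1 • (0 : Fin 3 → ℂ) + γ.1.complexLinear z := by
      funext z
      rw [← AffR3.smul_add_complex, zero_add]
      rfl
    rw [h]
    fun_prop
  have hcancel : IsCancelSMul Γ' (Fin 3 → ℂ) :=
    isCancelSMul_iff_eq_one_of_smul_eq.mpr fun γ z hz => by
      by_contra hne
      refine MargulisExample.smul_complex_ne (Subgroup.inclusion hle γ) (fun h => hne ?_) z hz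
      exact Subgroup.inclusion_injective hle (h.trans (map_one _).symm)
  have hp : IsQuotientCoveringMap (ComplexQuotient.proj Γ') Γ' :=
    isQuotientCoveringMap_quotientMk_of_properlyDiscontinuousSMul
  have hlin : ∀ (γ : Γ') (z v : Fin 3 → ℂ), γ • (z + v) = γ • z + γ.1.complexLinear v :=
    fun γ z v => γ.1.smul_add_complex z v
  refine ⟨Γ', hle, ⟨e'⟩,
    hp.isCoveringMap.isLocalHomeomorph.localInverseChartedSpace hp.surjective,
    hp.isLocalDiffeomorph_of_affine _ hlin, ?_, fun x => ?_, fun n hn x => ?_⟩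
  · let _ := hp.isCoveringMap.isLocalHomeomorph.localInverseChartedSpace hp.surjective
    exact ⟨t2Space_of_properlyDiscontinuousSMul_of_t2Space,
      ContinuousConstSMul.secondCountableTopology, hp.isManifold_of_affine _ hlin,
      hp.hasDominatingSpray_of_affine _ hlin⟩
  · obtain ⟨z, hz⟩ := hp.surjective x
    exact ⟨((hp.fundamentalGroupEquiv ⟨z, hz⟩).trans (MulEquiv.inv' Γ').symm).trans e'⟩
  · exact hp.isCoveringMap.subsingleton_homotopyGroup hp.surjective hn x
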